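/- An MV-algebra is a structure $(A,0,\neg,\oplus)$ where $(A,\oplus,0)$ is a commutative monoid, $\neg\neg x=x$, $x\oplus\neg 0=\neg 0$, and $\neg(\neg x\oplus y)\oplus y=\neg(\neg y\oplus x)\oplus x$; write $x\le y$ iff $\neg x\oplus y=\neg 0$. An ideal of $A$ is a subset containing $0$, closed under $\oplus$, and containing $x$ whenever it contains some $y\ge x$. For an ideal $I$, $A/I$ is the quotient of $A$ by the congruence $x\sim y \iff \neg(\neg x\oplus y)\oplus\neg(\neg y\oplus x)\in I$. A maximal ideal is a proper ideal that is maximal under inclusion among the proper ideals; it has finite rank if $A/\mathfrak m$ is finite. $\mathrm{MaxSpec}(A)$ is the set of maximal ideals of $A$ with the hull-kernel topology, for which the sets $\{\mathfrak m\mid a\in\mathfrak m\}$, $a\in A$, form a basis of closed sets. $A$ is semisimple if the intersection of its maximal ideals is $\{0\}$ (the intersection of the empty family being $A$). $A$ is residually finite if for all $x\neq y$ in $A$ there is a homomorphism $h$ of $A$ into a finite MV-algebra with $h(x)\neq h(y)$. **Theorem.** For any finitely generated MV-algebra $A$ the following conditions are equivalent: (i) $A$ is residually finite. (ii) $A$ is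 semisimple and its maximal ideals of finite rank form a dense subset of $\mathrm{MaxSpec}(A)$. -/

import Mathlib

universe u v

/-- An MV-algebra `(A, 0, ¬, ⊕)`, with truncated addition `⊕` written `+` and
negation `¬` written as a postfix `ᶜ`. -/
class MVAlgebra (A : Type u) extends AddCommMonoid A, Compl A where
  compl_compl' : ∀ x : A, xᶜᶜ = x
  add_compl_zero' : ∀ x : A, x + (0 : A)ᶜ = (0 : A)ᶜ
  lukasiewicz' : ∀ x y : A, (xᶜ + y)ᶜ + y = (yᶜ + x)ᶜ + x

/-- Homomorphisms of MV-algebras: maps preserving `0`, `⊕` and `¬`. -/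
structure MVHom (A : Type u) (B : Type v) [MVAlgebra A] [MVAlgebra B] extends A →+ B where
  map_compl' : ∀ x : A, toFun xᶜ = (toFun x)ᶜ

namespace MVAlgebra

variable {A : Type u} [MVAlgebra A]

/-- The natural order: `x ≤ y` iff `¬x ⊕ y = 1`, where `1 = ¬0`. -/
def Le (x y : A) : Prop := xᶜ + y = (0 : A)ᶜ

/-- Truncated difference `x ⊖ y = ¬(¬x ⊕ y)`. -/
def minus (x y : A) : A := (xᶜ + y)ᶜ

/-- The distance function `d(x, y) = (x ⊖ y) ⊕ (y ⊖ x)`. -/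
def dist (x y : A) : A := minus x y + minus y x

theorem compl_add_self (x : A) : xᶜ + x = (0 : A)ᶜ := by
  have h := lukasiewicz' x (0 : A)ᶜ
  rw [add_compl_zero', compl_compl', zero_add] at h
  exact h.symm

theorem le_iff_exists (x y : A) : Le x y ↔ ∃ w, y = x + w := by
  constructor
  · intro h
    refine ⟨(yᶜ + x)ᶜ, ?_⟩
    have h' := lukasiewicz' x y
    unfold Le at h
    rw [h, compl_compl', zero_add] at h'
    rw [add_comm, ← h']
  · rintro ⟨w, rfl⟩
    unfold Le
    rw [← add_assoc, compl_add_self, add_comm, add_compl_zero']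

theorem Le.rfl {x : A} : Le x x := compl_add_self x

theorem Le.trans {x y z : A} (h₁ : Le x y) (h₂ : Le y z) : Le x z := by
  rw [le_iff_exists] at *
  obtain ⟨a, rfl⟩ := h₁
  obtain ⟨b, rfl⟩ := h₂
  exact ⟨a + b, add_assoc _ _ _⟩

theorem le_add_right' (x y : A) : Le x (x + y) := (le_iff_exists _ _).2 ⟨y, rfl⟩

theorem le_add_left' (x y : A) : Le x (y + x) :=
  (le_iff_exists _ _).2 ⟨y, add_comm _ _⟩

theorem Le.add {x y z w : A} (h₁ : Le x y) (h₂ : Le z w) : Le (x + z) (y + w) := by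
  rw [le_iff_exists] at *
  obtain ⟨a, rfl⟩ := h₁
  obtain ⟨b, rfl⟩ := h₂
  exact ⟨a + b, add_add_add_comm _ _ _ _⟩

theorem minus_le_iff (x y z : A) : Le (minus x y) z ↔ Le x (y + z) := by
  unfold Le minus
  rw [compl_compl', add_assoc]

theorem le_add_minus (x y : A) : Le x (y + minus x y) := (minus_le_iff _ _ _).1 Le.rfl

theorem minus_self (x : A) : minus x x = 0 := by
  unfold minus
  rw [compl_add_self, compl_compl']

theorem minus_le_minus_add_minus (x y z : A) : Le (minus x z) (minus x y + minus y z) := by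
  rw [minus_le_iff]
  refine (le_add_minus x y).trans ?_
  have h := (le_add_minus y z).add (Le.rfl (x := minus x y))
  rwa [add_assoc, add_comm (minus y z)] at h

theorem add_minus_add_le (x y z w : A) :
    Le (minus (x + z) (y + w)) (minus x y + minus z w) := by
  rw [minus_le_iff, add_add_add_comm]
  exact (le_add_minus x y).add (le_add_minus z w)

theorem compl_minus_compl (x y : A) : minus xᶜ yᶜ = minus y x := by
  unfold minus
  rw [compl_compl', add_comm]

/-- The elements of the subalgebra of `A` generated by `S`. -/
inductive Generated (S : Set A) : A → Prop
  | basic (x : A) (hx : x ∈ S) : Generated S x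
  | zero : Generated S 0
  | add (x y : A) (hx : Generated S x) (hy : Generated S y) : Generated S (x + y)
  | compl (x : A) (hx : Generated S x) : Generated S xᶜ

variable (A) in
/-- `A` is generated, as an MV-algebra, by a finite set of elements. -/
def FinitelyGenerated : Prop := ∃ S : Set A, S.Finite ∧ ∀ x : A, Generated S x

variable (A) in
/-- Any two distinct elements of `A` are separated by a homomorphism into a finite MV-algebra. -/
def ResiduallyFinite : Prop :=
  ∀ x y : A, x ≠ y →
    ∃ (F : Type u) (_ : MVAlgebra F) (_ : Finite F) (h : MVHom A F),
      h.toFun x ≠ h.toFun y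

end MVAlgebra

open MVAlgebra in
/-- Ideals of an MV-algebra (here possibly improper): subsets containing `0`, closed under `⊕`,
and downward closed. -/
@[ext] structure MVIdeal (A : Type u) [MVAlgebra A] where
  carrier : Set A
  zero_mem' : (0 : A) ∈ carrier
  add_mem' : ∀ x y : A, x ∈ carrier → y ∈ carrier → x + y ∈ carrier
  lower' : ∀ x y : A, Le x y → y ∈ carrier → x ∈ carrier

namespace MVIdeal

open MVAlgebra

variable {A : Type u} [MVAlgebra A]

/-- A proper ideal which is not properly contained in any proper ideal. -/
def IsMaximal (I : MVIdeal A) : Prop :=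
  I.carrier ≠ Set.univ ∧
    ∀ J : MVIdeal A, I.carrier ⊆ J.carrier → J.carrier ≠ Set.univ → J = I

theorem dist_mem_iff (I : MVIdeal A) (x y : A) :
    dist x y ∈ I.carrier ↔ minus x y ∈ I.carrier ∧ minus y x ∈ I.carrier :=
  ⟨fun h => ⟨I.lower' _ _ (le_add_right' _ _) h, I.lower' _ _ (le_add_left' _ _) h⟩,
    fun h => I.add_mem' _ _ h.1 h.2⟩

/-- The congruence of an ideal: `x ∼ y` iff `d(x, y) ∈ I`. -/
def con (I : MVIdeal A) : AddCon A where
  r x y := dist x y ∈ I.carrier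
  iseqv := by
    simp only [dist_mem_iff]
    refine ⟨fun x => ?_, fun h => h.symm, fun h₁ h₂ => ⟨?_, ?_⟩⟩
    · rw [minus_self]
      exact ⟨I.zero_mem', I.zero_mem'⟩
    · exact I.lower' _ _ (minus_le_minus_add_minus _ _ _) (I.add_mem' _ _ h₁.1 h₂.1)
    · exact I.lower' _ _ (minus_le_minus_add_minus _ _ _) (I.add_mem' _ _ h₂.2 h₁.2)
  add' := by
    intro w x y z h₁ h₂
    rw [dist_mem_iff] at *
    exact ⟨I.lower' _ _ (add_minus_add_le _ _ _ _) (I.add_mem' _ _ h₁.1 h₂.1),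
      I.lower' _ _ (add_minus_add_le _ _ _ _) (I.add_mem' _ _ h₁.2 h₂.2)⟩

/-- The quotient MV-algebra `A / I`. -/
def Quotient (I : MVIdeal A) : Type u := I.con.Quotient

instance (I : MVIdeal A) : AddCommMonoid I.Quotient :=
  inferInstanceAs (AddCommMonoid I.con.Quotient)

instance (I : MVIdeal A) : Compl I.Quotient where
  compl := Quotient.map' (fun x : A => xᶜ) (by
    intro x y h
    change dist xᶜ yᶜ ∈ I.carrier
    have h' : dist x y ∈ I.carrier := h
    rw [dist_mem_iff] at *
    rw [compl_minus_compl, compl_minus_compl]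
    exact h'.symm)

instance (I : MVIdeal A) : MVAlgebra I.Quotient where
  compl_compl' := by
    rintro ⟨x⟩
    exact congrArg (fun a : A => (a : I.con.Quotient)) (compl_compl' x)
  add_compl_zero' := by
    rintro ⟨x⟩
    exact congrArg (fun a : A => (a : I.con.Quotient)) (add_compl_zero' x)
  lukasiewicz' := by
    rintro ⟨x⟩ ⟨y⟩
    exact congrArg (fun a : A => (a : I.con.Quotient)) (lukasiewicz' x y)

end MVIdeal

/-- The set of maximal ideals of `A`. -/
def MaxSpec (A : Type u) [MVAlgebra A] : Type u := {I : MVIdeal A // I.IsMaximal}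

namespace MaxSpec

/-- The hull-kernel topology: the sets `{m | a ∈ m}`, for `a ∈ A`, are a basis of closed sets. -/
instance (A : Type u) [MVAlgebra A] : TopologicalSpace (MaxSpec A) :=
  TopologicalSpace.generateFrom
    {U | ∃ a : A, U = {m : MaxSpec A | a ∈ m.1.carrier}ᶜ}

/-- A maximal ideal has finite rank if its quotient MV-algebra is finite. -/
def FiniteRank {A : Type u} [MVAlgebra A] (m : MaxSpec A) : Prop := Finite m.1.Quotient

end MaxSpec

/-- The intersection of the maximal ideals of `A` is `{0}`. -/
def MVAlgebra.Semisimple (A : Type u) [MVAlgebra A] : Prop :=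
  (⋂ m : MaxSpec A, m.1.carrier) = {(0 : A)}

/-!
Neither implication needs `A` to be finitely generated; both rest on the fact that the open sets
`{m | a ∉ m}` form a basis of `MaxSpec A`.

If `A` is semisimple with a dense set of maximal ideals of finite rank, then for `x ≠ y` the
distance `dist x y` is nonzero, hence lies outside some maximal ideal; by density it lies outside
some `m` of finite rank, and the projection `A → A / m` separates `x` from `y`.

Conversely it suffices that every `a ≠ 0` avoids some maximal ideal of finite rank
(`exists_finiteRank_notMem`). Residual finiteness gives a homomorphism `h` into a finite algebra `F`
with `h a ≠ 0`. In `F` some multiple `e = n • h a` is idempotent, so its complement generates a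
proper ideal; a maximal ideal `M` above it cannot contain `h a`. The preimage of `M` under `h` is
maximal because an ideal is maximal exactly when it is proper and every `a` outside it has a
multiple whose complement is inside (`MVIdeal.isMaximal_iff`), a condition which passes to
preimages. The quotient is finite because points with the same image under `h` are congruent.

The same criterion yields the basis: if `(n • a)ᶜ` and `(k • b)ᶜ` lie in `m`, then so does their sum
`c`, and the basic open set of `cᶜ` is a neighbourhood of `m` contained in those of `a` and `b`.
-/

/-! ### Order and idempotents -/

namespace MVAlgebra

variable {A : Type u} [MVAlgebra A]

theorem Le.antisymm {x y : A} (h₁ : Le x y) (h₂ : Le y x) : x = y := by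
  have h := lukasiewicz' x y
  unfold Le at h₁ h₂
  rw [h₁, h₂, compl_compl', zero_add, zero_add] at h
  exact h.symm

theorem le_compl_zero (x : A) : Le x (0 : A)ᶜ := add_compl_zero' xᶜ

theorem zero_le' (x : A) : Le 0 x := by
  simpa using le_add_right' (0 : A) x

theorem eq_of_dist_eq_zero {x y : A} (h : dist x y = 0) : x = y := by
  have key : ∀ u v : A, Le (minus u v) 0 → Le u v := fun u v huv => by
    simpa using (minus_le_iff u v 0).1 huv
  exact Le.antisymm (key _ _ (h ▸ le_add_right' _ _)) (key _ _ (h ▸ le_add_left' _ _))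

theorem compl_add_compl_of_add_self {e : A} (he : e + e = e) : eᶜ + eᶜ = eᶜ := by
  have h := lukasiewicz' eᶜ e
  rw [compl_compl', he, compl_add_self] at h
  exact Le.antisymm h.symm (le_add_right' _ _)

/-- The multiples `n • a` increase, so in a finite algebra they stabilize, at an idempotent. -/
theorem exists_nsmul_add_self [Finite A] (a : A) :
    ∃ n : ℕ, n ≠ 0 ∧ n • a + n • a = n • a := by
  obtain ⟨p, q, hpq, h⟩ : ∃ p q : ℕ, p < q ∧ p • a = q • a := by
    obtain ⟨p, q, hne, h⟩ := Finite.exists_ne_map_eq_of_infinite (fun n : ℕ => n • a)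
    rcases lt_or_gt_of_ne hne with hlt | hlt
    · exact ⟨p, q, hlt, h⟩
    · exact ⟨q, p, hlt, h.symm⟩
  have hle : ∀ i j : ℕ, i ≤ j → Le (i • a) (j • a) := fun i j hij => by
    obtain ⟨k, rfl⟩ := Nat.exists_eq_add_of_le hij
    rw [add_nsmul]
    exact le_add_right' _ _
  have hsucc : p • a + a = p • a := by
    refine Le.antisymm ?_ (le_add_right' _ _)
    rw [← succ_nsmul, h]
    exact hle _ _ hpq
  have hadd : ∀ k : ℕ, p • a + k • a = p • a := fun k => by
    induction k with
    | zero => simp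
    | succ k ih => rw [succ_nsmul, ← add_assoc, ih, hsucc]
  -- `p` may be `0` (when `a = 0`), whereas `p + 1` is positive with the same multiple.
  refine ⟨p + 1, p.succ_ne_zero, ?_⟩
  rw [succ_nsmul, hsucc, hadd]

end MVAlgebra

/-! ### Maximal ideals -/

namespace MVIdeal

open MVAlgebra

variable {A : Type u} [MVAlgebra A]

theorem carrier_ne_univ_iff (I : MVIdeal A) :
    I.carrier ≠ Set.univ ↔ (0 : A)ᶜ ∉ I.carrier := by
  rw [not_iff_not]
  refine ⟨fun h => h ▸ Set.mem_univ _, fun h => Set.eq_univ_of_forall fun x => ?_⟩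
  exact I.lower' _ _ (le_compl_zero x) h

theorem nsmul_mem (I : MVIdeal A) {a : A} (ha : a ∈ I.carrier) (n : ℕ) : n • a ∈ I.carrier := by
  induction n with
  | zero => simpa using I.zero_mem'
  | succ n ih =>
    rw [succ_nsmul]
    exact I.add_mem' _ _ ih ha

theorem notMem_of_compl_mem {I : MVIdeal A} (hI : I.carrier ≠ Set.univ) {a : A}
    (h : aᶜ ∈ I.carrier) : a ∉ I.carrier := fun ha =>
  (I.carrier_ne_univ_iff.1 hI) (compl_add_self a ▸ I.add_mem' _ _ h ha)

/-- The ideal generated by `I` and the element `a`. -/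
def adjoin (I : MVIdeal A) (a : A) : MVIdeal A where
  carrier := {y | ∃ i ∈ I.carrier, ∃ n : ℕ, Le y (i + n • a)}
  zero_mem' := ⟨0, I.zero_mem', 0, zero_le' _⟩
  add_mem' := by
    rintro x y ⟨i, hi, n, hx⟩ ⟨j, hj, k, hy⟩
    refine ⟨i + j, I.add_mem' _ _ hi hj, n + k, ?_⟩
    rw [add_nsmul, add_add_add_comm]
    exact hx.add hy
  lower' := by
    rintro x y hxy ⟨i, hi, n, hy⟩
    exact ⟨i, hi, n, hxy.trans hy⟩

theorem subset_adjoin (I : MVIdeal A) (a : A) : I.carrier ⊆ (I.adjoin a).carrier :=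
  fun i hi => ⟨i, hi, 0, le_add_right' _ _⟩

theorem mem_adjoin_self (I : MVIdeal A) (a : A) : a ∈ (I.adjoin a).carrier :=
  ⟨0, I.zero_mem', 1, by simpa using Le.rfl⟩

/-- Maximality of `I`, expressed by elements: the quotient by `I` is nontrivial and simple. -/
theorem isMaximal_iff (I : MVIdeal A) :
    I.IsMaximal ↔
      I.carrier ≠ Set.univ ∧ ∀ a ∉ I.carrier, ∃ n : ℕ, (n • a)ᶜ ∈ I.carrier := by
  constructor
  · refine fun hI => ⟨hI.1, fun a ha => ?_⟩
    have htop : (I.adjoin a).carrier = Set.univ := by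
      by_contra hne
      apply ha
      rw [← hI.2 _ (I.subset_adjoin a) hne]
      exact I.mem_adjoin_self a
    obtain ⟨i, hi, n, hn⟩ : (0 : A)ᶜ ∈ (I.adjoin a).carrier := htop ▸ Set.mem_univ _
    refine ⟨n, I.lower' _ _ ?_ hi⟩
    rw [Le, compl_compl', add_comm]
    exact (le_compl_zero _).antisymm hn
  · rintro ⟨hI, h⟩
    refine ⟨hI, fun J hIJ hJ => MVIdeal.ext (Set.Subset.antisymm (fun a ha => ?_) hIJ)⟩
    by_contra haI
    obtain ⟨n, hn⟩ := h a haI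
    exact notMem_of_compl_mem hJ (hIJ hn) (J.nsmul_mem ha n)

theorem exists_isMaximal_of_finite [Finite A] (I : MVIdeal A) (hI : I.carrier ≠ Set.univ) :
    ∃ M : MVIdeal A, M.IsMaximal ∧ I.carrier ⊆ M.carrier := by
  obtain ⟨_, hIM, ⟨M, hM, rfl⟩, hmax⟩ :=
    (Set.toFinite {S : Set A | ∃ J : MVIdeal A,
      J.carrier ≠ Set.univ ∧ J.carrier = S}).exists_le_maximal ⟨I, hI, rfl⟩
  exact ⟨M, ⟨hM, fun J hMJ hJ =>
    MVIdeal.ext (Set.Subset.antisymm (hmax ⟨J, hJ, rfl⟩ hMJ) hMJ)⟩, hIM⟩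

/-- The ideal of all elements below an idempotent. -/
def ofIdempotent (e : A) (he : e + e = e) : MVIdeal A where
  carrier := {y | Le y e}
  zero_mem' := zero_le' e
  add_mem' := fun x y hx hy => by
    have h := Le.add hx hy
    rwa [he] at h
  lower' := fun _ _ hxy hy => hxy.trans hy

/-- Finite MV-algebras are semisimple. -/
theorem exists_isMaximal_notMem_of_finite [Finite A] {a : A} (ha : a ≠ 0) :
    ∃ M : MVIdeal A, M.IsMaximal ∧ a ∉ M.carrier := by
  obtain ⟨n, hn, he⟩ := exists_nsmul_add_self a
  obtain ⟨M, hM, hle⟩ := exists_isMaximal_of_finite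
    (ofIdempotent (n • a)ᶜ (compl_add_compl_of_add_self he)) (by
      rw [carrier_ne_univ_iff]
      intro h
      -- `1 ≤ (n • a)ᶜ` says that `n • a ≤ 0`, while `a ≤ n • a`.
      have h0 : Le (n • a) 0 := by
        have h' : ((0 : A)ᶜ)ᶜ + (n • a)ᶜ = (0 : A)ᶜ := h
        rw [compl_compl', zero_add] at h'
        rw [Le, add_zero, h']
      obtain ⟨k, rfl⟩ := Nat.exists_eq_succ_of_ne_zero hn
      rw [Nat.succ_eq_add_one, succ_nsmul] at h0
      exact ha (((le_add_left' a (k • a)).trans h0).antisymm (zero_le' a)))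
  exact ⟨M, hM, fun h => notMem_of_compl_mem hM.1 (hle Le.rfl) (M.nsmul_mem h n)⟩

/-! ### Homomorphisms -/

/-- The projection of `A` onto `A / I`. -/
def mkHom (I : MVIdeal A) : MVHom A I.Quotient where
  toFun a := (a : I.con.Quotient)
  map_zero' := rfl
  map_add' _ _ := rfl
  map_compl' _ := rfl

theorem mkHom_eq_iff (I : MVIdeal A) (x y : A) :
    I.mkHom.toFun x = I.mkHom.toFun y ↔ dist x y ∈ I.carrier :=
  AddCon.eq I.con

variable {B : Type v} [MVAlgebra B]

theorem _root_.MVHom.map_minus (h : MVHom A B) (x y : A) :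
    h.toFun (minus x y) = minus (h.toFun x) (h.toFun y) := by
  unfold minus
  rw [h.map_compl', h.map_add', h.map_compl']

theorem _root_.MVHom.map_dist (h : MVHom A B) (x y : A) :
    h.toFun (dist x y) = dist (h.toFun x) (h.toFun y) := by
  unfold MVAlgebra.dist
  rw [h.map_add', h.map_minus, h.map_minus]

/-- The preimage of an ideal under a homomorphism. -/
def comap (h : MVHom A B) (I : MVIdeal B) : MVIdeal A where
  carrier := h.toFun ⁻¹' I.carrier
  zero_mem' := by
    rw [Set.mem_preimage, h.map_zero']
    exact I.zero_mem'
  add_mem' := fun x y hx hy => by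
    rw [Set.mem_preimage, h.map_add']
    exact I.add_mem' _ _ hx hy
  lower' := fun x y hxy hy => by
    refine I.lower' _ _ ?_ hy
    have h' := congrArg h.toFun hxy
    rwa [h.map_add', h.map_compl', h.map_compl', h.map_zero'] at h'

theorem IsMaximal.comap (h : MVHom A B) {I : MVIdeal B} (hI : I.IsMaximal) :
    (I.comap h).IsMaximal := by
  rw [isMaximal_iff, carrier_ne_univ_iff] at *
  refine ⟨fun h1 => hI.1 ?_, fun a ha => ?_⟩
  · have h1' : h.toFun (0 : A)ᶜ ∈ I.carrier := h1
    rwa [h.map_compl', h.map_zero'] at h1'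
  · obtain ⟨n, hn⟩ := hI.2 _ ha
    refine ⟨n, ?_⟩
    change h.toFun (n • a)ᶜ ∈ I.carrier
    rw [h.map_compl']
    have hs : h.toFun (n • a) = n • h.toFun a := map_nsmul h.toAddMonoidHom n a
    rwa [hs]

theorem finite_quotient_comap [Finite B] (h : MVHom A B) (I : MVIdeal B) :
    Finite (I.comap h).Quotient := by
  have hsurj : Function.Surjective (I.comap h).mkHom.toFun := AddCon.mk'_surjective
  refine Finite.of_injective
    (fun q => h.toFun (Function.surjInv hsurj q)) fun p q hpq => ?_
  rw [← Function.surjInv_eq hsurj p, ← Function.surjInv_eq hsurj q, mkHom_eq_iff]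
  change h.toFun (dist _ _) ∈ I.carrier
  have hpq' : h.toFun (Function.surjInv hsurj p) = h.toFun (Function.surjInv hsurj q) := hpq
  rw [h.map_dist, hpq', dist_mem_iff, minus_self]
  exact ⟨I.zero_mem', I.zero_mem'⟩

end MVIdeal

/-! ### The hull-kernel topology and residual finiteness -/

open MVAlgebra MVIdeal

section

variable {A : Type u} [MVAlgebra A]

theorem MaxSpec.isTopologicalBasis :
    TopologicalSpace.IsTopologicalBasis
      {U | ∃ a : A, U = {m : MaxSpec A | a ∈ m.1.carrier}ᶜ} where
  exists_subset_inter := by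
    rintro _ ⟨a, rfl⟩ _ ⟨b, rfl⟩ m ⟨ha, hb⟩
    have hm := (isMaximal_iff m.1).1 m.2
    obtain ⟨n, hn⟩ := hm.2 a ha
    obtain ⟨k, hk⟩ := hm.2 b hb
    have hc : (((n • a)ᶜ + (k • b)ᶜ)ᶜ)ᶜ ∈ m.1.carrier := by
      rw [compl_compl']
      exact m.1.add_mem' _ _ hn hk
    refine ⟨_, ⟨((n • a)ᶜ + (k • b)ᶜ)ᶜ, rfl⟩, notMem_of_compl_mem hm.1 hc, fun p hp => ?_⟩
    have hle : ∀ x y : A, Le (xᶜ + y)ᶜ x := fun x y => by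
      rw [Le, compl_compl', add_right_comm, compl_add_self, add_comm, add_compl_zero']
    refine ⟨fun hpa => hp ?_, fun hpb => hp ?_⟩
    · exact p.1.lower' _ _ (hle _ _) (p.1.nsmul_mem hpa n)
    · rw [add_comm]
      exact p.1.lower' _ _ (hle _ _) (p.1.nsmul_mem hpb k)
  sUnion_eq := Set.eq_univ_of_forall fun m =>
    ⟨_, ⟨(0 : A)ᶜ, rfl⟩, (carrier_ne_univ_iff _).1 m.2.1⟩
  eq_generateFrom := rfl

theorem MVAlgebra.ResiduallyFinite.exists_finiteRank_notMem (hA : ResiduallyFinite A) {a : A}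
    (ha : a ≠ 0) : ∃ m : MaxSpec A, m.FiniteRank ∧ a ∉ m.1.carrier := by
  obtain ⟨F, _, _, h, hne⟩ := hA a 0 ha
  rw [h.map_zero'] at hne
  obtain ⟨M, hM, haM⟩ := exists_isMaximal_notMem_of_finite hne
  exact ⟨⟨M.comap h, hM.comap h⟩, finite_quotient_comap h M, haM⟩

end

theorem theorem2p1 (A : Type u) [MVAlgebra A] (hA : MVAlgebra.FinitelyGenerated A) :
    MVAlgebra.ResiduallyFinite A ↔
      MVAlgebra.Semisimple A ∧ Dense {m : MaxSpec A | m.FiniteRank} := by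
  constructor
  · intro hres
    refine ⟨Set.Subset.antisymm (fun a ha => ?_) ?_, ?_⟩
    · by_contra h0
      obtain ⟨m, -, hm⟩ := hres.exists_finiteRank_notMem h0
      exact hm (Set.mem_iInter.1 ha m)
    · rintro _ rfl
      exact Set.mem_iInter.2 fun m => m.1.zero_mem'
    · rw [MaxSpec.isTopologicalBasis.dense_iff]
      rintro _ ⟨a, rfl⟩ ⟨p, hp⟩
      obtain ⟨m, hfin, hm⟩ := hres.exists_finiteRank_notMem
        (a := a) (fun h0 => hp (h0 ▸ p.1.zero_mem'))
      exact ⟨m, hm, hfin⟩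
  · rintro ⟨hss, hdense⟩ x y hxy
    have hd : dist x y ∉ ⋂ m : MaxSpec A, m.1.carrier := by
      rw [show (⋂ m : MaxSpec A, m.1.carrier) = {(0 : A)} from hss]
      exact fun h => hxy (eq_of_dist_eq_zero h)
    obtain ⟨p, hp⟩ := not_forall.1 (mt Set.mem_iInter.2 hd)
    obtain ⟨m, hm, hfin⟩ := hdense.inter_open_nonempty _
      (MaxSpec.isTopologicalBasis.isOpen ⟨dist x y, rfl⟩) ⟨p, hp⟩
    exact ⟨m.1.Quotient, inferInstance, hfin, m.1.mkHom, fun h => hm ((mkHom_eq_iff _ _ _).1 h)⟩
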